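/- Consider $\lambda$-terms in de Bruijn notation, built from indices $\underline{0},\underline{1},\underline{2},\dots$, abstractions $\lambda M$ and applications $M\,N$, with size $|\underline{n}|=n+1$, $|\lambda M|=|M|+1$, $|M\,N|=|M|+|N|+1$. A term is $m$-open if prefixing it with $m$ abstractions gives a closed term. A closure is a pair $\langle M,e\rangle$ of a term $M$ and an environment $e$, i.e. a finite list of closures; its size is the sum of the sizes of all terms occurring in it. A closure $\langle M,e\rangle$ is closed if $M$ is $p$-open, where $p$ is the length of $e$, and all closures in $e$ are closed. Let $c_{0,n}$ be the number of closed closures of size $n$, let $L_\infty(z)$ be the generating function of all $\lambda$-terms by size, let $L_0(z)$ be that of the closed ($0$-open) terms, and let $\rho_{L_\infty}$ be the dominant singularity (radius of convergence) of $L_\infty$. Then $$\rho_{L_\infty}=\frac13\left(\sqrt[3]{26+6\sqrt{33}}-\frac{4\cdot 2^{2/3}}{\sqrt[3]{13+3\sqrt{33}}}-1\right)\doteq 0.29559,$$ and there exist $0<\overline{\rho}<\underline{\rho}<\rho_{L_\infty}$, namely $\overline{\rho}=\frac{1}{10}\left(25-\sqrt{545}\right)$ and a solution $\underline{\rho}$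 of $L_0(\underline{\rho})=\frac14$, and positive functions $\theta,\kappa$ on the natural numbers with $$\lim_{n\to\infty}\theta(n)^{1/n}=\lim_{n\to\infty}\kappa(n)^{1/n}=1$$ (so in particular both upper limits are $1$), such that for all sufficiently large $n$ $$\underline{\rho}^{-n}\,\theta(n)<c_{0,n}<\overline{\rho}^{-n}\,\kappa(n).$$ -/

import Mathlib

open Filter Topology

/-- Lambda-terms in de Bruijn notation; indices start at `0`. -/
inductive LambdaTerm : Type
  | var : ℕ → LambdaTerm
  | lam : LambdaTerm → LambdaTerm
  | app : LambdaTerm → LambdaTerm → LambdaTerm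

namespace LambdaTerm

/-- The natural size: the index `n` is `n` successors applied to `0`, hence has size `n + 1`;
abstractions and applications contribute `1`. -/
def size : LambdaTerm → ℕ
  | var n => n + 1
  | lam M => M.size + 1
  | app M N => M.size + N.size + 1

/-- `M` is `m`-open: prefixing `M` with `m` abstractions gives a closed term, i.e. every index `n`
occurring in `M` below exactly `k` abstractions of `M` satisfies `n < m + k`.
The closed terms are the `0`-open ones. -/
def IsMOpen : ℕ → LambdaTerm → Prop
  | m, var n => n < m
  | m, lam M => IsMOpen (m + 1) M
  | m, app M N => IsMOpen m M ∧ IsMOpen m N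

end LambdaTerm

mutual

/-- A closure is a couple of a lambda-term and an environment. -/
inductive LambdaClosure : Type
  | couple : LambdaTerm → LambdaEnv → LambdaClosure

/-- An environment is a finite list of closures. -/
inductive LambdaEnv : Type
  | nil : LambdaEnv
  | cons : LambdaClosure → LambdaEnv → LambdaEnv

end

/-- The number of closures an environment consists of (at top level). -/
def LambdaEnv.length : LambdaEnv → ℕ
  | .nil => 0
  | .cons _ e => e.length + 1

mutual

/-- The size of a closure: the total size of the lambda-terms in it. -/
def LambdaClosure.size : LambdaClosure → ℕ
  | .couple M e => M.size + e.size

/-- The size of an environment: the total size of the lambda-terms in it. -/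
def LambdaEnv.size : LambdaEnv → ℕ
  | .nil => 0
  | .cons c e => c.size + e.size

end

mutual

/-- The closure `⟨M, e⟩` is `m`-open if `M` is `(m + p)`-open, where `p` is the length of `e`, and
all closures of `e` are `m`-open. -/
def LambdaClosure.IsMOpen (m : ℕ) : LambdaClosure → Prop
  | .couple M e => M.IsMOpen (m + e.length) ∧ e.IsMOpen m

/-- All closures of the environment are `m`-open. -/
def LambdaEnv.IsMOpen (m : ℕ) : LambdaEnv → Prop
  | .nil => True
  | .cons c e => c.IsMOpen m ∧ e.IsMOpen m

end

/-- The number `l_n` of all (plain) lambda-terms of size `n`. -/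
noncomputable def plainTermCount (n : ℕ) : ℕ :=
  Set.ncard {M : LambdaTerm | M.size = n}

/-- The number of `m`-open lambda-terms of size `n`; for `m = 0`, of closed ones. -/
noncomputable def openTermCount (m n : ℕ) : ℕ :=
  Set.ncard {M : LambdaTerm | M.IsMOpen m ∧ M.size = n}

/-- The number `c_{m,n}` of `m`-open closures of size `n`; for `m = 0`, of closed ones. -/
noncomputable def openClosureCount (m n : ℕ) : ℕ :=
  Set.ncard {c : LambdaClosure | c.IsMOpen m ∧ c.size = n}

/-- The dominant singularity of `L_∞(z) = ∑ l_n z ^ n`: as the coefficients are non-negative, it is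
the radius of convergence of this power series. -/
noncomputable def plainTermRadius : ENNReal :=
  (FormalMultilinearSeries.ofScalars ℝ (fun n : ℕ => (plainTermCount n : ℝ))).radius

/-!
Every generating function is treated as a sum of `z ^ size` over a type, with values in `ℝ≥0∞`;
decomposing terms and closures by their outermost constructor turns such sums into algebraic
equations that hold with or without convergence. Write `L_m` for the generating function of the
`m`-open terms and `C` for that of the closed closures.

*Radius of `L_∞`.* The equation `L_∞ = z / (1 - z) + z L_∞ + z L_∞ ^ 2` forces the discriminant to
be non-negative where `L_∞` converges, and conversely a real root of the quadratic bounds the sums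
over terms of bounded size by induction. Hence the radius is the root of `(1 - z) ^ 3 = 4 z ^ 2`
(`plainTermRadius_eq`), which Cardano's formula gives explicitly (`cardano_root`).

*Upper bound.* At `(25 - √545) / 10` the value of `L_∞` is at most `1 / 4`. Closures with arbitrary
terms are plane trees with nodes labelled by terms, so their generating function is then at most
`1 / 2` (`LambdaClosure.genFun_univ_le`), and its terms are bounded.

*The point where `L_0 = 1 / 4`.* At `(25 - √545) / 10` one has `L_0 < 1 / 4`. Just before the
singularity of `L_∞` a lower bound on `L_9` is propagated to `L_0` through
`L_m = (z + ⋯ + z ^ m) + z L_{m+1} + z L_m ^ 2`, giving `L_0 > 1 / 4`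
(`LambdaTerm.quarter_lt_genFun_closed`). The intermediate value theorem gives the solution.

*Lower bound.* Putting a closed closure in front of the environment of another one is injective,
adds sizes and keeps closures closed. So the counts are supermultiplicative, and by Fekete's lemma
their `n`-th roots converge (`exists_tendsto_log_div`); it also gives `L_0 + C ^ 2 ≤ C`. Where `C`
converges this means `L_0 ≤ C - C ^ 2 ≤ 1 / 4`, so `C` diverges beyond the solution of `L_0 = 1 / 4`
and the growth rate is at least its inverse (`growth_add_log_nonneg`).
-/

open scoped ENNReal NNReal

/-! ### Generating functions as sums over a type -/

/-- The generating function, by the size `w`, of the set `s` of objects: the sum of `z ^ w a` over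
`a ∈ s`. Its values lie in `ℝ≥0∞`, so that no convergence has to be assumed. -/
noncomputable def genFun {α : Type*} (w : α → ℕ) (s : Set α) (z : ℝ≥0∞) : ℝ≥0∞ :=
  ∑' a, s.indicator (fun a => z ^ w a) a

namespace genFun

variable {α : Type*} {w : α → ℕ} {s t : Set α} {z : ℝ≥0∞}

lemma mono (h : s ⊆ t) : genFun w s z ≤ genFun w t z :=
  ENNReal.tsum_le_tsum fun a => Set.indicator_le_indicator_of_subset h (fun _ => zero_le) a

lemma mono_right {y : ℝ≥0∞} (h : y ≤ z) : genFun w s y ≤ genFun w s z :=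
  ENNReal.tsum_le_tsum fun _ => Set.indicator_le_indicator (pow_le_pow_left₀ zero_le h _)

lemma le_of_forall_truncation {B : ℝ≥0∞} (h : ∀ N, genFun w {a ∈ s | w a < N} z ≤ B) :
    genFun w s z ≤ B := by
  classical
  rw [genFun, ENNReal.tsum_eq_iSup_sum]
  refine iSup_le fun F => ?_
  refine le_trans ?_ (h (F.sup w + 1))
  refine le_trans (Finset.sum_le_sum fun a ha => ?_) (ENNReal.sum_le_tsum F)
  have : w a ≤ F.sup w := Finset.le_sup ha
  by_cases hs : a ∈ s <;> simp [Set.indicator, hs, this]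

/-- A convergent generating function has finitely many objects of each size. -/
lemma finite_fiber (hz : z ≠ 0) (h : genFun w s z ≠ ∞) (n : ℕ) :
    {a | a ∈ s ∧ w a = n}.Finite := by
  rcases eq_or_ne z ∞ with rfl | hz'
  · -- At `z = ∞` every object contributes at least `1`.
    refine (ENNReal.finite_const_le_of_tsum_ne_top h one_ne_zero).subset ?_
    rintro a ⟨ha, -⟩
    simp only [Set.mem_ofPred_eq, Set.indicator_of_mem ha]
    exact one_le_pow₀ le_top
  · refine (ENNReal.finite_const_le_of_tsum_ne_top h (ε := z ^ n) (pow_ne_zero n hz)).subset ?_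
    rintro a ⟨ha, rfl⟩
    simp [Set.indicator_of_mem ha]

/-- Grouping the objects by size gives the generating function in its usual form. -/
lemma eq_tsum_ncard (hfin : ∀ n, {a | a ∈ s ∧ w a = n}.Finite) :
    genFun w s z = ∑' n, ({a | a ∈ s ∧ w a = n}.ncard : ℝ≥0∞) * z ^ n := by
  rw [genFun, ← ENNReal.tsum_fiberwise _ w]
  refine tsum_congr fun n => ?_
  rw [tsum_subtype (w ⁻¹' {n})]
  have : ∀ a, (w ⁻¹' {n}).indicator (s.indicator fun a => z ^ w a) a
      = {a | a ∈ s ∧ w a = n}.indicator (fun _ => z ^ n) a := by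
    intro a
    by_cases h1 : w a = n <;> by_cases h2 : a ∈ s <;> simp [Set.indicator, h1, h2]
  rw [tsum_congr this, ← tsum_subtype _ (fun _ => z ^ n), ENNReal.tsum_set_const,
    ← (hfin n).cast_ncard_eq]
  simp

/-- If every object has positive size, the generating function grows at least linearly. -/
lemma mul_le_of_pos (hw : ∀ a, 0 < w a) {c : ℝ≥0∞} (hc : 1 ≤ c) :
    c * genFun w s z ≤ genFun w s (c * z) := by
  rw [genFun, ← ENNReal.tsum_mul_left]
  refine ENNReal.tsum_le_tsum fun a => ?_
  by_cases h : a ∈ s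
  · simp only [Set.indicator_of_mem h, mul_pow]
    gcongr
    exact le_self_pow₀ hc (hw a).ne'
  · simp [h]

end genFun

lemma ENNReal.tsum_sum_type {α β : Type*} (f : α ⊕ β → ℝ≥0∞) :
    ∑' x, f x = ∑' a, f (.inl a) + ∑' b, f (.inr b) :=
  Summable.tsum_sum (f := f) ENNReal.summable ENNReal.summable

/-! ### Recursive equations for terms -/

namespace LambdaTerm

/-- A lambda-term is an index, an abstraction, or an application. -/
def equivSum : ℕ ⊕ (LambdaTerm ⊕ (LambdaTerm × LambdaTerm)) ≃ LambdaTerm where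
  toFun
    | .inl n => var n
    | .inr (.inl M) => lam M
    | .inr (.inr (M, N)) => app M N
  invFun
    | var n => .inl n
    | lam M => .inr (.inl M)
    | app M N => .inr (.inr (M, N))
  left_inv := by rintro (n | M | ⟨M, N⟩) <;> rfl
  right_inv := by rintro (n | M | ⟨M, N⟩) <;> rfl

lemma tsum_eq (f : LambdaTerm → ℝ≥0∞) :
    ∑' M, f M = ∑' n, f (var n) + (∑' M, f (lam M) + ∑' M, ∑' N, f (app M N)) := by
  rw [← equivSum.tsum_eq, ENNReal.tsum_sum_type, ENNReal.tsum_sum_type, ENNReal.tsum_prod']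
  rfl

lemma size_pos (M : LambdaTerm) : 0 < M.size := by
  cases M <;> simp [size]

lemma IsMOpen.succ {m : ℕ} {M : LambdaTerm} (h : M.IsMOpen m) : M.IsMOpen (m + 1) := by
  induction M generalizing m with
  | var n => exact Nat.lt_succ_of_lt h
  | lam M ih => exact ih h
  | app M N ihM ihN => exact ⟨ihM h.1, ihN h.2⟩

lemma tsum_indicator_app {s t u : Set LambdaTerm} (z : ℝ≥0∞)
    (h : ∀ M N, app M N ∈ s ↔ M ∈ t ∧ N ∈ u) :
    ∑' M, ∑' N, s.indicator (fun M => z ^ M.size) (app M N)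
      = z * genFun size t z * genFun size u z := by
  rw [mul_assoc, genFun, genFun, ← ENNReal.tsum_mul_right, ← ENNReal.tsum_mul_left]
  refine tsum_congr fun M => ?_
  rw [← ENNReal.tsum_mul_left, ← ENNReal.tsum_mul_left]
  refine tsum_congr fun N => ?_
  by_cases h1 : M ∈ t <;> by_cases h2 : N ∈ u <;>
    simp [Set.indicator, h, h1, h2, size, pow_add, mul_comm]

lemma tsum_indicator_lam {s t : Set LambdaTerm} (z : ℝ≥0∞) (h : ∀ M, lam M ∈ s ↔ M ∈ t) :
    ∑' M, s.indicator (fun M => z ^ M.size) (lam M) = z * genFun size t z := by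
  rw [genFun, ← ENNReal.tsum_mul_left]
  refine tsum_congr fun M => ?_
  by_cases h1 : M ∈ t <;> simp [Set.indicator, h, h1, size, pow_add, mul_comm]

/-- `L_∞ = z / (1 - z) + z L_∞ + z L_∞ ^ 2`. -/
lemma genFun_univ_eq (z : ℝ≥0∞) :
    genFun size Set.univ z = ∑' n : ℕ, z ^ (n + 1) +
      (z * genFun size Set.univ z + z * genFun size Set.univ z * genFun size Set.univ z) := by
  conv_lhs => rw [genFun, tsum_eq]
  rw [tsum_indicator_lam (t := Set.univ) z (by simp),
    tsum_indicator_app (t := Set.univ) (u := Set.univ) z (by simp)]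
  simp [size]

/-- `L_m = (z + ⋯ + z ^ m) + z L_{m+1} + z L_m ^ 2`. -/
lemma genFun_isMOpen_eq (m : ℕ) (z : ℝ≥0∞) :
    genFun size {M | M.IsMOpen m} z = ∑ n ∈ Finset.range m, z ^ (n + 1) +
      (z * genFun size {M | M.IsMOpen (m + 1)} z +
        z * genFun size {M | M.IsMOpen m} z * genFun size {M | M.IsMOpen m} z) := by
  conv_lhs => rw [genFun, tsum_eq]
  rw [tsum_indicator_lam (t := {M | M.IsMOpen (m + 1)}) z (by simp [IsMOpen]),
    tsum_indicator_app (t := {M | M.IsMOpen m}) (u := {M | M.IsMOpen m}) z (by simp [IsMOpen]),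
    tsum_eq_sum (s := Finset.range m)]
  · congr 1
    refine Finset.sum_congr rfl fun n hn => ?_
    have : n < m := by simpa using hn
    simp [Set.indicator, IsMOpen, size, this]
  · intro n hn
    have : ¬ n < m := by simpa using hn
    simp [Set.indicator, IsMOpen, this]

/-- A supersolution of the equation for `L_∞` bounds `L_∞` from above: by induction it bounds the
generating function of the terms of size less than `N`, for every `N`. -/
lemma genFun_univ_le {z B : ℝ≥0∞} (hB : ∑' n : ℕ, z ^ (n + 1) + (z * B + z * B * B) ≤ B) :
    genFun size Set.univ z ≤ B := by
  refine genFun.le_of_forall_truncation fun N => ?_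
  induction N with
  | zero => simp [genFun]
  | succ N ih =>
    set t : Set LambdaTerm := {M ∈ Set.univ | M.size < N} with ht
    refine le_trans ?_ hB
    rw [genFun, tsum_eq]
    gcongr ?_ + (?_ + ?_)
    · exact ENNReal.tsum_le_tsum fun n => Set.indicator_le_self' (by simp) _
    · rw [tsum_indicator_lam (t := t) z (by simp [ht, size])]
      gcongr
    · refine le_trans ?_ (mul_le_mul' (mul_le_mul' le_rfl ih) ih)
      rw [← tsum_indicator_app (s := {P | ∃ M ∈ t, ∃ N ∈ t, P = app M N}) (t := t) (u := t) z
        (by simp)]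
      refine ENNReal.tsum_le_tsum fun M => ENNReal.tsum_le_tsum fun P => ?_
      by_cases h : (app M P).size < N + 1
      · have h1 : M ∈ t := ⟨trivial, by simp only [size] at h; omega⟩
        have h2 : P ∈ t := ⟨trivial, by simp only [size] at h; omega⟩
        rw [Set.indicator_of_mem (by simpa using h),
          Set.indicator_of_mem (by exact ⟨M, h1, P, h2, rfl⟩)]
      · rw [Set.indicator_of_notMem (by simpa using h)]
        exact zero_le

/-! ### The radius of convergence of the generating function of all terms -/

lemma tsum_pow_succ_ofReal {x : ℝ} (h0 : 0 ≤ x) (h1 : x < 1) :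
    ∑' n : ℕ, ENNReal.ofReal x ^ (n + 1) = ENNReal.ofReal (x / (1 - x)) := by
  have h : HasSum (fun n : ℕ => x ^ (n + 1)) (x / (1 - x)) := by
    simpa [pow_succ', div_eq_mul_inv] using (hasSum_geometric_of_lt_one h0 h1).mul_left x
  rw [← h.tsum_eq, ENNReal.ofReal_tsum_of_nonneg (fun n => by positivity) h.summable]
  simp_rw [ENNReal.ofReal_pow h0]

lemma genFun_univ_le_ofReal {x B : ℝ} (h0 : 0 ≤ x) (h1 : x < 1) (hB0 : 0 ≤ B)
    (hB : x / (1 - x) + (x * B + x * B * B) ≤ B) :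
    genFun size Set.univ (ENNReal.ofReal x) ≤ ENNReal.ofReal B := by
  have : 0 ≤ x / (1 - x) := div_nonneg h0 (by linarith)
  refine genFun_univ_le ?_
  rw [tsum_pow_succ_ofReal h0 h1, ← ENNReal.ofReal_mul h0, ← ENNReal.ofReal_mul (by positivity),
    ← ENNReal.ofReal_add (by positivity) (by positivity),
    ← ENNReal.ofReal_add (by positivity) (by positivity)]
  exact ENNReal.ofReal_le_ofReal hB

/-- `L_∞` converges where the discriminant of its quadratic equation is non-negative. -/
lemma genFun_univ_ne_top {x : ℝ} (h0 : 0 < x) (h1 : x < 1) (hx : 4 * x ^ 2 ≤ (1 - x) ^ 3) :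
    genFun size Set.univ (ENNReal.ofReal x) ≠ ∞ := by
  have h1' : 0 < 1 - x := by linarith
  -- The bound is the vertex of the parabola `B ↦ x B ^ 2 - (1 - x) B + x / (1 - x)`.
  refine ne_top_of_le_ne_top ENNReal.ofReal_ne_top
    (genFun_univ_le_ofReal (B := (1 - x) / (2 * x)) h0.le h1 (by positivity) ?_)
  rw [← sub_nonneg]
  have : (1 - x) / (2 * x) - (x / (1 - x) + (x * ((1 - x) / (2 * x)) +
      x * ((1 - x) / (2 * x)) * ((1 - x) / (2 * x))))
      = ((1 - x) ^ 3 - 4 * x ^ 2) / (4 * x * (1 - x)) := by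
    field_simp
    ring
  rw [this]
  exact div_nonneg (by linarith) (by positivity)

/-- `L_∞` diverges where the discriminant of its quadratic equation is negative. -/
lemma discrim_nonneg_of_genFun_univ_ne_top {x : ℝ} (h0 : 0 < x)
    (h : genFun size Set.univ (ENNReal.ofReal x) ≠ ∞) : x < 1 ∧ 4 * x ^ 2 ≤ (1 - x) ^ 3 := by
  set z := ENNReal.ofReal x with hz
  set W := genFun size Set.univ z with hW
  set v := ∑' n : ℕ, z ^ (n + 1) with hv
  have hzx : z.toReal = x := ENNReal.toReal_ofReal h0.le
  have hzt : z ≠ ∞ := ENNReal.ofReal_ne_top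
  have hWeq : W = v + (z * W + z * W * W) := genFun_univ_eq z
  have hvt : v ≠ ∞ := ne_top_of_le_ne_top h (hWeq ▸ le_self_add)
  have hveq : v = z + z * v := by
    rw [hv, ← ENNReal.tsum_mul_left, tsum_eq_zero_add' ENNReal.summable]
    simp [pow_succ']
  have e1 : v.toReal = x + x * v.toReal := by
    conv_lhs => rw [hveq]
    rw [ENNReal.toReal_add hzt (ENNReal.mul_ne_top hzt hvt), ENNReal.toReal_mul, hzx]
  have e2 : W.toReal = v.toReal + (x * W.toReal + x * W.toReal * W.toReal) := by
    have hzW := ENNReal.mul_ne_top hzt h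
    have hzWW := ENNReal.mul_ne_top hzW h
    conv_lhs => rw [hWeq]
    rw [ENNReal.toReal_add hvt (ENNReal.add_ne_top.2 ⟨hzW, hzWW⟩), ENNReal.toReal_add hzW hzWW,
      ENNReal.toReal_mul, ENNReal.toReal_mul, ENNReal.toReal_mul, hzx]
  have hv0 : 0 ≤ v.toReal := ENNReal.toReal_nonneg
  have hx1 : x < 1 := by nlinarith
  refine ⟨hx1, ?_⟩
  have e3 : (1 - x) ^ 2 - 4 * x * v.toReal = (1 - x - 2 * x * W.toReal) ^ 2 := by
    linear_combination 4 * x * e2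
  have e4 : (1 - x) * ((1 - x) ^ 2 - 4 * x * v.toReal) = (1 - x) ^ 3 - 4 * x ^ 2 := by
    linear_combination -4 * x * e1
  have : 0 ≤ (1 - x) * (1 - x - 2 * x * W.toReal) ^ 2 :=
    mul_nonneg (by linarith) (sq_nonneg _)
  rw [← e3, e4] at this
  linarith

lemma finite_size_eq (n : ℕ) : {M : LambdaTerm | M ∈ Set.univ ∧ M.size = n}.Finite :=
  genFun.finite_fiber (z := ENNReal.ofReal (1 / 10)) (by simp)
    (genFun_univ_ne_top (by norm_num) (by norm_num) (by norm_num)) n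

lemma genFun_univ_eq_tsum (z : ℝ≥0∞) :
    genFun size Set.univ z = ∑' n, (plainTermCount n : ℝ≥0∞) * z ^ n := by
  rw [genFun.eq_tsum_ncard finite_size_eq]
  simp [plainTermCount]

lemma genFun_isMOpen_eq_tsum (m : ℕ) (z : ℝ≥0∞) :
    genFun size {M | M.IsMOpen m} z = ∑' n, (openTermCount m n : ℝ≥0∞) * z ^ n :=
  genFun.eq_tsum_ncard fun n => (finite_size_eq n).subset fun _ h => ⟨trivial, h.2⟩

end LambdaTerm

lemma summable_iff_tsum_natCast_ne_top (a : ℕ → ℕ) {x : ℝ} (hx : 0 ≤ x) :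
    Summable (fun n => (a n : ℝ) * x ^ n) ↔ ∑' n, (a n : ℝ≥0∞) * ENNReal.ofReal x ^ n ≠ ∞ := by
  lift x to ℝ≥0 using hx
  rw [ENNReal.ofReal_coe_nnreal]
  have := ENNReal.tsum_coe_ne_top_iff_summable_coe (f := fun n => (a n : ℝ≥0) * x ^ n)
  push_cast at this
  exact this.symm

/-- The radius of convergence of `L_∞` is the point where the discriminant vanishes. -/
lemma plainTermRadius_eq {ρ : ℝ} (h0 : 0 < ρ) (h1 : ρ < 1) (h : (1 - ρ) ^ 3 = 4 * ρ ^ 2) :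
    plainTermRadius = ENNReal.ofReal ρ := by
  apply le_antisymm
  · refine ENNReal.le_of_forall_nnreal_lt fun r hr => ?_
    by_contra! hlt
    have hρr : ρ < r := by
      rwa [ENNReal.ofReal, ENNReal.coe_lt_coe, Real.toNNReal_lt_iff_lt_coe h0.le] at hlt
    have hs := FormalMultilinearSeries.summable_norm_mul_pow _ hr
    simp only [FormalMultilinearSeries.ofScalars_norm, Real.norm_natCast] at hs
    rw [summable_iff_tsum_natCast_ne_top _ (NNReal.coe_nonneg r), ← LambdaTerm.genFun_univ_eq_tsum] at hs
    obtain ⟨hr1, hr⟩ := LambdaTerm.discrim_nonneg_of_genFun_univ_ne_top (h0.trans hρr) hs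
    have : (1 - (r : ℝ)) ^ 3 < (1 - ρ) ^ 3 :=
      pow_lt_pow_left₀ (by linarith) (by linarith) (by norm_num)
    have : ρ ^ 2 < (r : ℝ) ^ 2 := pow_lt_pow_left₀ hρr h0.le (by norm_num)
    linarith
  · refine FormalMultilinearSeries.le_radius_of_summable _ ?_
    simp only [FormalMultilinearSeries.ofScalars_norm, Real.norm_natCast]
    rw [summable_iff_tsum_natCast_ne_top _ (NNReal.coe_nonneg _),
      ← LambdaTerm.genFun_univ_eq_tsum, Real.coe_toNNReal _ h0.le]
    exact LambdaTerm.genFun_univ_ne_top h0 h1 h.ge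

/-- Cardano's formula for the real root of `z ^ 3 + z ^ 2 + 3 z - 1`. -/
lemma cardano_root {x : ℝ} (hx : x = (1 / 3) * ((26 + 6 * √33) ^ ((1 : ℝ) / 3)
    - 4 * (2 : ℝ) ^ ((2 : ℝ) / 3) / (13 + 3 * √33) ^ ((1 : ℝ) / 3) - 1)) :
    x ^ 3 + x ^ 2 + 3 * x - 1 = 0 := by
  have hs : √33 ^ 2 = 33 := Real.sq_sqrt (by norm_num)
  have hs0 : 0 ≤ √33 := Real.sqrt_nonneg _
  set a := (26 + 6 * √33) ^ ((1 : ℝ) / 3) with ha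
  have ha0 : 0 < a := by positivity
  have ha3 : a ^ 3 = 26 + 6 * √33 := by
    rw [ha, ← Real.rpow_natCast, ← Real.rpow_mul (by positivity)]; norm_num
  have hd : a = 2 ^ ((1 : ℝ) / 3) * (13 + 3 * √33) ^ ((1 : ℝ) / 3) := by
    rw [ha, ← Real.mul_rpow (by norm_num) (by positivity)]; ring_nf
  have h2 : (2 : ℝ) ^ ((1 : ℝ) / 3) * (2 : ℝ) ^ ((2 : ℝ) / 3) = 2 := by
    rw [← Real.rpow_add (by norm_num)]; norm_num
  have hb : 4 * (2 : ℝ) ^ ((2 : ℝ) / 3) / (13 + 3 * √33) ^ ((1 : ℝ) / 3) = 8 / a := by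
    rw [div_eq_div_iff (by positivity) ha0.ne', hd]
    linear_combination 4 * (13 + 3 * √33) ^ ((1 : ℝ) / 3) * h2
  rw [hb] at hx
  -- With `b = 8 / a` one has `a ^ 3 - b ^ 3 = 52` and `3 x + 1 = a - b`.
  set b := 8 / a with hbdef
  have hab : a * b = 8 := by rw [hbdef]; field_simp
  have hb3 : b ^ 3 = 6 * √33 - 26 := by
    have h512 : (a * b) ^ 3 = 512 := by rw [hab]; norm_num
    rw [mul_pow, ha3] at h512
    have hp : (26 + 6 * √33) ≠ 0 := by positivity
    apply mul_left_cancel₀ hp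
    rw [h512]
    linear_combination -36 * hs
  have hx' : a - b = 3 * x + 1 := by rw [hx]; ring
  have : (a - b) ^ 3 + 24 * (a - b) - 52 = 0 := by
    linear_combination ha3 - hb3 - 3 * (a - b) * hab
  rw [hx'] at this
  linear_combination this / 27

lemma cubic_strictMono : StrictMono fun x : ℝ => x ^ 3 + x ^ 2 + 3 * x := by
  intro x y h
  have : 0 < (x + y + 1) ^ 2 + x ^ 2 + y ^ 2 + 1 := by positivity
  dsimp only
  nlinarith [mul_pos (sub_pos.2 h) this]

/-! ### Numerical estimates for closed terms -/

namespace LambdaTerm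

/-- The equation for `L_m` between real numbers, at a point where `L_∞` converges. -/
lemma toReal_genFun_isMOpen_eq {x : ℝ} (h0 : 0 ≤ x)
    (hW : genFun size Set.univ (ENNReal.ofReal x) ≠ ∞) (m : ℕ) :
    (genFun size {M | M.IsMOpen m} (ENNReal.ofReal x)).toReal =
      ∑ n ∈ Finset.range m, x ^ (n + 1) +
        (x * (genFun size {M | M.IsMOpen (m + 1)} (ENNReal.ofReal x)).toReal +
          x * (genFun size {M | M.IsMOpen m} (ENNReal.ofReal x)).toReal ^ 2) := by
  have hz : ENNReal.ofReal x ≠ ∞ := ENNReal.ofReal_ne_top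
  have hL : ∀ m, genFun size {M | M.IsMOpen m} (ENNReal.ofReal x) ≠ ∞ := fun m =>
    ne_top_of_le_ne_top hW (genFun.mono (Set.subset_univ _))
  have h1 := ENNReal.mul_ne_top hz (hL (m + 1))
  have h2 := ENNReal.mul_ne_top hz (hL m)
  have h3 := ENNReal.mul_ne_top h2 (hL m)
  have hs : ∀ n ∈ Finset.range m, ENNReal.ofReal x ^ (n + 1) ≠ ∞ :=
    fun n _ => ENNReal.pow_ne_top hz
  conv_lhs => rw [genFun_isMOpen_eq]
  rw [ENNReal.toReal_add (ENNReal.sum_ne_top.2 hs) (ENNReal.add_ne_top.2 ⟨h1, h3⟩),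
    ENNReal.toReal_add h1 h3, ENNReal.toReal_sum hs]
  simp only [ENNReal.toReal_mul, ENNReal.toReal_pow, ENNReal.toReal_ofReal h0]
  ring

/-- A lower bound on `L_{m+1}` gives one on `L_m`: `t` lies below both roots of the quadratic
inequality satisfied by `L_m`. -/
lemma le_toReal_genFun_isMOpen {x : ℝ} (h0 : 0 < x)
    (hW : genFun size Set.univ (ENNReal.ofReal x) ≠ ∞) {m : ℕ} {y t : ℝ}
    (ht : t ≤ ∑ n ∈ Finset.range m, x ^ (n + 1) + (x * y + x * t ^ 2)) (hxt : 2 * x * t ≤ 1)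
    (hy : y ≤ (genFun size {M | M.IsMOpen (m + 1)} (ENNReal.ofReal x)).toReal) :
    t ≤ (genFun size {M | M.IsMOpen m} (ENNReal.ofReal x)).toReal := by
  have h := toReal_genFun_isMOpen_eq h0.le hW m
  set l := (genFun size {M | M.IsMOpen m} (ENNReal.ofReal x)).toReal
  by_contra! hlt
  have h1 : x * y ≤ x * (genFun size {M | M.IsMOpen (m + 1)} (ENNReal.ofReal x)).toReal :=
    mul_le_mul_of_nonneg_left hy h0.le
  have h2 : (t - l) * (1 - x * (t + l)) ≤ 0 := by nlinarith
  have h3 : x * (t + l) < 1 := by nlinarith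
  nlinarith [mul_pos (sub_pos.2 hlt) (sub_pos.2 h3)]

/-- An initial lower bound on `L_m`, obtained from its equation and `L_m ≤ L_{m+1}`. -/
lemma le_toReal_genFun_isMOpen_self {x : ℝ} (h0 : 0 < x)
    (hW : genFun size Set.univ (ENNReal.ofReal x) ≠ ∞) {m : ℕ} {t : ℝ}
    (ht : t ≤ ∑ n ∈ Finset.range m, x ^ (n + 1) + (x * t + x * t ^ 2))
    (hxt : 2 * x * t ≤ 1 - x) :
    t ≤ (genFun size {M | M.IsMOpen m} (ENNReal.ofReal x)).toReal := by
  have h := toReal_genFun_isMOpen_eq h0.le hW m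
  have hmono : (genFun size {M | M.IsMOpen m} (ENNReal.ofReal x)).toReal ≤
      (genFun size {M | M.IsMOpen (m + 1)} (ENNReal.ofReal x)).toReal :=
    ENNReal.toReal_mono (ne_top_of_le_ne_top hW (genFun.mono (Set.subset_univ _)))
      (genFun.mono fun M hM => IsMOpen.succ hM)
  set l := (genFun size {M | M.IsMOpen m} (ENNReal.ofReal x)).toReal
  by_contra! hlt
  have h1 := mul_le_mul_of_nonneg_left hmono h0.le
  have h2 : (t - l) * (1 - x - x * (t + l)) ≤ 0 := by nlinarith
  have h3 : x * (t + l) < 1 - x := by nlinarith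
  nlinarith [mul_pos (sub_pos.2 hlt) (sub_pos.2 h3)]

/-- `L_0` exceeds `1 / 4` slightly before the singularity `0.295597…` of `L_∞`; its value at the
singularity is only about `0.2508`. -/
lemma quarter_lt_genFun_closed :
    1 / 4 < (genFun size {M | M.IsMOpen 0} (ENNReal.ofReal (295597 / 10 ^ 6))).toReal := by
  have h0 : (0 : ℝ) < 295597 / 10 ^ 6 := by norm_num
  have hW := genFun_univ_ne_top h0 (by norm_num) (by norm_num)
  -- The bounds on `L_9, …, L_0` are the small roots of the successive quadratics, rounded down.
  have h9 := le_toReal_genFun_isMOpen_self h0 hW (m := 9) (t := 11854851 / 10000000)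
    (by norm_num [Finset.sum_range_succ]) (by norm_num)
  have h8 := le_toReal_genFun_isMOpen h0 hW (t := 118541 / 100000)
    (by norm_num [Finset.sum_range_succ]) (by norm_num) h9
  have h7 := le_toReal_genFun_isMOpen h0 hW (t := 118514 / 100000)
    (by norm_num [Finset.sum_range_succ]) (by norm_num) h8
  have h6 := le_toReal_genFun_isMOpen h0 hW (t := 118422 / 100000)
    (by norm_num [Finset.sum_range_succ]) (by norm_num) h7
  have h5 := le_toReal_genFun_isMOpen h0 hW (t := 118110 / 100000)
    (by norm_num [Finset.sum_range_succ]) (by norm_num) h6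
  have h4 := le_toReal_genFun_isMOpen h0 hW (t := 117067 / 100000)
    (by norm_num [Finset.sum_range_succ]) (by norm_num) h5
  have h3 := le_toReal_genFun_isMOpen h0 hW (t := 113695 / 100000)
    (by norm_num [Finset.sum_range_succ]) (by norm_num) h4
  have h2 := le_toReal_genFun_isMOpen h0 hW (t := 103680 / 100000)
    (by norm_num [Finset.sum_range_succ]) (by norm_num) h3
  have h1 := le_toReal_genFun_isMOpen h0 hW (t := 78354 / 100000)
    (by norm_num [Finset.sum_range_succ]) (by norm_num) h2
  have h0 := le_toReal_genFun_isMOpen h0 hW (t := 25009 / 100000)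
    (by norm_num [Finset.sum_range_succ]) (by norm_num) h1
  linarith

lemma genFun_closed_le {x B : ℝ} (h0 : 0 ≤ x) (hB : 0 ≤ B)
    (h : genFun size Set.univ (ENNReal.ofReal x) ≤ ENNReal.ofReal B) :
    genFun size {M | M.IsMOpen 0} (ENNReal.ofReal x) ≤ ENNReal.ofReal (x * B + x * B * B) := by
  have h' : ∀ m, genFun size {M | M.IsMOpen m} (ENNReal.ofReal x) ≤ ENNReal.ofReal B := fun m =>
    (genFun.mono (Set.subset_univ _)).trans h
  rw [genFun_isMOpen_eq, ENNReal.ofReal_add (by positivity) (by positivity),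
    ENNReal.ofReal_mul (by positivity), ENNReal.ofReal_mul (by positivity),
    ENNReal.ofReal_mul (by positivity)]
  simp only [Finset.range_zero, Finset.sum_empty, zero_add]
  gcongr <;> exact h' _

/-- The equation `L_0(ρ) = 1 / 4` has a solution between any point where `L_0` is smaller and
`0.295597`. -/
lemma exists_hasSum_quarter {a : ℝ} (ha0 : 0 ≤ a) (ha : a ≤ 295597 / 10 ^ 6)
    (hlt : genFun size {M | M.IsMOpen 0} (ENNReal.ofReal a) < ENNReal.ofReal (1 / 4)) :
    ∃ ρ, a < ρ ∧ ρ < 295597 / 10 ^ 6 ∧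
      HasSum (fun n : ℕ => (openTermCount 0 n : ℝ) * ρ ^ n) (1 / 4) := by
  set b : ℝ := 295597 / 10 ^ 6 with hb
  have hb0 : 0 ≤ b := by norm_num [hb]
  have hfin : genFun size {M | M.IsMOpen 0} (ENNReal.ofReal b) ≠ ∞ :=
    ne_top_of_le_ne_top (genFun_univ_ne_top (by norm_num [hb]) (by norm_num [hb])
      (by norm_num [hb])) (genFun.mono (Set.subset_univ _))
  have hsum : ∀ x, 0 ≤ x → x ≤ b → Summable (fun n : ℕ => (openTermCount 0 n : ℝ) * x ^ n) := by
    intro x hx0 hxb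
    rw [summable_iff_tsum_natCast_ne_top _ hx0, ← genFun_isMOpen_eq_tsum]
    exact ne_top_of_le_ne_top hfin (genFun.mono_right (ENNReal.ofReal_le_ofReal hxb))
  have hval : ∀ x, 0 ≤ x → (genFun size {M | M.IsMOpen 0} (ENNReal.ofReal x)).toReal
      = ∑' n, (openTermCount 0 n : ℝ) * x ^ n := by
    intro x hx0
    rw [genFun_isMOpen_eq_tsum, ENNReal.tsum_toReal_eq
      fun n => ENNReal.mul_ne_top (by simp) (ENNReal.pow_ne_top ENNReal.ofReal_ne_top)]
    simp [ENNReal.toReal_ofReal hx0]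
  have hcont : ContinuousOn (fun x => ∑' n, (openTermCount 0 n : ℝ) * x ^ n) (Set.Icc a b) := by
    refine continuousOn_tsum (fun n => by fun_prop) (hsum b hb0 le_rfl) fun n x hx => ?_
    have hx0 : 0 ≤ x := ha0.trans hx.1
    rw [Real.norm_of_nonneg (by positivity)]
    gcongr
    exact hx.2
  have hfa : ∑' n, (openTermCount 0 n : ℝ) * a ^ n < 1 / 4 := by
    rw [← hval a ha0]
    exact (ENNReal.lt_ofReal_iff_toReal_lt (ne_top_of_lt hlt)).1 hlt
  have hfb : 1 / 4 < ∑' n, (openTermCount 0 n : ℝ) * b ^ n := by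
    rw [← hval b hb0]
    exact quarter_lt_genFun_closed
  obtain ⟨ρ, ⟨h1, h2⟩, h3⟩ := intermediate_value_Ioo ha hcont ⟨hfa, hfb⟩
  refine ⟨ρ, h1, h2, ?_⟩
  rw [← h3]
  exact (hsum ρ (ha0.trans h1.le) h2.le).hasSum

end LambdaTerm

/-! ### Closures -/

/-- An environment is empty or a closure followed by an environment. -/
def LambdaEnv.equivSum : Unit ⊕ (LambdaClosure × LambdaEnv) ≃ LambdaEnv where
  toFun
    | .inl _ => .nil
    | .inr (c, e) => .cons c e
  invFun
    | .nil => .inl ()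
    | .cons c e => .inr (c, e)
  left_inv := by rintro (_ | ⟨c, e⟩) <;> rfl
  right_inv := by rintro (_ | ⟨c, e⟩) <;> rfl

/-- A closure is a term together with an environment. -/
def LambdaClosure.equivProd : LambdaTerm × LambdaEnv ≃ LambdaClosure where
  toFun p := .couple p.1 p.2
  invFun
    | .couple M e => (M, e)
  left_inv _ := rfl
  right_inv := by rintro ⟨M, e⟩; rfl

namespace LambdaClosure

lemma size_pos (c : LambdaClosure) : 0 < c.size := by
  obtain ⟨M, e⟩ := c
  simp only [size]
  have := M.size_pos
  omega

/-- If `L_∞ ≤ 1 / 4`, the generating function of all closures is at most `1 / 2`: with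
`C = L_∞ E` and `E = 1 + C E`, the bounds `C ≤ 1 / 2` and `E ≤ 2` propagate along the size. -/
lemma genFun_univ_le {z : ℝ≥0∞} (h : genFun LambdaTerm.size Set.univ z ≤ 1 / 4) :
    genFun size Set.univ z ≤ 1 / 2 := by
  have key : ∀ N, genFun size {c ∈ Set.univ | c.size < N} z ≤ 1 / 2 ∧
      genFun LambdaEnv.size {e ∈ Set.univ | e.size < N} z ≤ 2 := by
    intro N
    induction N with
    | zero => simp [genFun]
    | succ N ih =>
      have hC : genFun size {c ∈ Set.univ | c.size < N + 1} z ≤ 1 / 2 := by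
        calc genFun size {c ∈ Set.univ | c.size < N + 1} z
            = ∑' M, ∑' e, {c ∈ Set.univ | size c < N + 1}.indicator (fun c => z ^ size c)
                (couple M e) := by
              rw [genFun, ← equivProd.tsum_eq, ENNReal.tsum_prod']; rfl
          _ ≤ ∑' M : LambdaTerm, ∑' e, z ^ M.size *
                {e ∈ Set.univ | LambdaEnv.size e < N}.indicator (fun e => z ^ e.size) e := by
              refine ENNReal.tsum_le_tsum fun M => ENNReal.tsum_le_tsum fun e => ?_
              by_cases hlt : M.size + e.size < N + 1
              · have := M.size_pos
                rw [Set.indicator_of_mem (by simpa [size] using hlt),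
                  Set.indicator_of_mem (by simp; omega), size, pow_add]
              · rw [Set.indicator_of_notMem (by simpa [size] using hlt)]
                exact zero_le
          _ = genFun LambdaTerm.size Set.univ z *
                genFun LambdaEnv.size {e ∈ Set.univ | e.size < N} z := by
              simp_rw [ENNReal.tsum_mul_left, ENNReal.tsum_mul_right]
              simp [genFun]
          _ ≤ 1 / 4 * 2 := mul_le_mul' h ih.2
          _ = 1 / 2 := by
              rw [← ENNReal.toReal_eq_toReal_iff' (by finiteness) (by finiteness)]
              norm_num
      refine ⟨hC, ?_⟩
      calc genFun LambdaEnv.size {e ∈ Set.univ | e.size < N + 1} z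
          = 1 + ∑' c, ∑' e, {e ∈ Set.univ | LambdaEnv.size e < N + 1}.indicator
              (fun e => z ^ e.size) (.cons c e) := by
            rw [genFun, ← LambdaEnv.equivSum.tsum_eq, ENNReal.tsum_sum_type, ENNReal.tsum_prod']
            simp [LambdaEnv.equivSum, Set.indicator, LambdaEnv.size]
        _ ≤ 1 + ∑' c, ∑' e, {c ∈ Set.univ | size c < N + 1}.indicator (fun c => z ^ c.size) c *
              {e ∈ Set.univ | LambdaEnv.size e < N}.indicator (fun e => z ^ e.size) e := by
            refine add_le_add_right
              (ENNReal.tsum_le_tsum fun c => ENNReal.tsum_le_tsum fun e => ?_) 1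
            by_cases hlt : c.size + e.size < N + 1
            · have := c.size_pos
              rw [Set.indicator_of_mem (by simpa [LambdaEnv.size] using hlt),
                Set.indicator_of_mem (by simp; omega), Set.indicator_of_mem (by simp; omega),
                LambdaEnv.size, pow_add]
            · rw [Set.indicator_of_notMem (by simpa [LambdaEnv.size] using hlt)]
              exact zero_le
        _ = 1 + genFun size {c ∈ Set.univ | c.size < N + 1} z *
              genFun LambdaEnv.size {e ∈ Set.univ | e.size < N} z := by
            simp_rw [ENNReal.tsum_mul_left, ENNReal.tsum_mul_right]
            rfl
        _ ≤ 1 + 1 / 2 * 2 := by gcongr; exact ih.2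
        _ = 2 := by
            rw [one_div, ENNReal.inv_mul_cancel two_ne_zero ENNReal.ofNat_ne_top,
              one_add_one_eq_two]
  exact genFun.le_of_forall_truncation fun N => (key N).1

lemma genFun_univ_ofReal_le {x : ℝ} (h0 : 0 ≤ x) (h1 : x < 1)
    (hx : x / (1 - x) + (x * (1 / 4) + x * (1 / 4) * (1 / 4)) ≤ 1 / 4) :
    genFun size Set.univ (ENNReal.ofReal x) ≤ 1 / 2 := by
  refine genFun_univ_le ((LambdaTerm.genFun_univ_le_ofReal h0 h1 (by norm_num) hx).trans_eq ?_)
  rw [ENNReal.ofReal_div_of_pos (by norm_num)]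
  simp

lemma finite_size_eq (n : ℕ) : {c : LambdaClosure | c ∈ Set.univ ∧ c.size = n}.Finite := by
  refine genFun.finite_fiber (z := ENNReal.ofReal (1 / 10)) (by simp) ?_ n
  exact ne_top_of_le_ne_top (by finiteness)
    (genFun_univ_ofReal_le (by norm_num) (by norm_num) (by norm_num))

lemma finite_isMOpen_size_eq (m n : ℕ) : {c : LambdaClosure | c.IsMOpen m ∧ c.size = n}.Finite :=
  (finite_size_eq n).subset fun _ h => ⟨trivial, h.2⟩

lemma genFun_isMOpen_eq_tsum (m : ℕ) (z : ℝ≥0∞) :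
    genFun size {c | c.IsMOpen m} z = ∑' n, (openClosureCount m n : ℝ≥0∞) * z ^ n :=
  genFun.eq_tsum_ncard (finite_isMOpen_size_eq m)

/-- The closure obtained by putting `c` in front of the environment. -/
def push (c : LambdaClosure) : LambdaClosure → LambdaClosure
  | couple M e => couple M (.cons c e)

lemma push_injective : Function.Injective fun p : LambdaClosure × LambdaClosure => push p.1 p.2 := by
  rintro ⟨c, ⟨M, e⟩⟩ ⟨c', ⟨M', e'⟩⟩ h
  simp only [push, couple.injEq, LambdaEnv.cons.injEq] at h
  simp [h]

lemma size_push (c d : LambdaClosure) : (push c d).size = c.size + d.size := by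
  obtain ⟨M, e⟩ := d
  simp only [push, size, LambdaEnv.size]
  omega

lemma IsMOpen.push {m : ℕ} {c d : LambdaClosure} (hc : c.IsMOpen m) (hd : d.IsMOpen m) :
    (LambdaClosure.push c d).IsMOpen m := by
  obtain ⟨M, e⟩ := d
  simp only [LambdaClosure.push, IsMOpen, LambdaEnv.IsMOpen, LambdaEnv.length] at hd ⊢
  exact ⟨hd.1.succ, hc, hd.2⟩

/-- Closed terms in the empty environment and closures of the form `push c d` are different closed
closures, whence `L_0 + C ^ 2 ≤ C`. -/
lemma genFun_closed_add_sq_le (z : ℝ≥0∞) :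
    genFun LambdaTerm.size {M | M.IsMOpen 0} z +
      genFun size {c | c.IsMOpen 0} z * genFun size {c | c.IsMOpen 0} z ≤
        genFun size {c | c.IsMOpen 0} z := by
  let f : LambdaTerm ⊕ (LambdaClosure × LambdaClosure) → LambdaClosure :=
    Sum.elim (fun M => couple M .nil) (fun p => push p.1 p.2)
  have hf : Function.Injective f := by
    refine Function.Injective.sumElim (fun M N h => by simpa using h) push_injective ?_
    rintro M ⟨c, ⟨N, e⟩⟩ h
    simp [push] at h
  refine le_trans ?_ (ENNReal.tsum_comp_le_tsum_of_injective hf _)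
  rw [ENNReal.tsum_sum_type, ENNReal.tsum_prod']
  refine add_le_add (ENNReal.tsum_le_tsum fun M => ?_) ?_
  · by_cases h : M.IsMOpen 0
    · simp [f, Set.indicator, h, IsMOpen, LambdaEnv.IsMOpen, LambdaEnv.length, size,
        LambdaEnv.size]
    · simp [h]
  · rw [genFun, ← ENNReal.tsum_mul_right]
    refine ENNReal.tsum_le_tsum fun c => ?_
    rw [← ENNReal.tsum_mul_left]
    refine ENNReal.tsum_le_tsum fun d => ?_
    by_cases hc : c.IsMOpen 0 <;> by_cases hd : d.IsMOpen 0 <;> simp [f, hc, hd]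
    simp [hc.push hd, size_push, pow_add]

end LambdaClosure

lemma openClosureCount_mul_le (k m n : ℕ) :
    openClosureCount k m * openClosureCount k n ≤ openClosureCount k (m + n) := by
  rw [openClosureCount, openClosureCount, ← Set.ncard_prod]
  refine Set.ncard_le_ncard_of_injOn (fun p => LambdaClosure.push p.1 p.2) ?_
    LambdaClosure.push_injective.injOn (LambdaClosure.finite_isMOpen_size_eq k _)
  rintro ⟨c, d⟩ ⟨hc, hd⟩
  exact ⟨hc.1.push hd.1, by rw [LambdaClosure.size_push, hc.2, hd.2]⟩

/-- The sequence is monotone because a closure stays open when its term is put under an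
abstraction. -/
lemma openClosureCount_monotone (k : ℕ) : Monotone (openClosureCount k) := by
  refine monotone_nat_of_le_succ fun n => ?_
  let f : LambdaClosure → LambdaClosure
    | .couple M e => .couple (.lam M) e
  refine Set.ncard_le_ncard_of_injOn f ?_ ?_ (LambdaClosure.finite_isMOpen_size_eq k _)
  · rintro ⟨M, e⟩ ⟨h1, h2⟩
    refine ⟨⟨LambdaTerm.IsMOpen.succ h1.1, h1.2⟩, ?_⟩
    simp only [f, LambdaClosure.size, LambdaTerm.size] at h2 ⊢
    omega
  · rintro ⟨M, e⟩ - ⟨M', e'⟩ - h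
    simpa [f] using h

lemma openClosureCount_pos (k : ℕ) {n : ℕ} (hn : 2 ≤ n) : 0 < openClosureCount k n := by
  refine lt_of_lt_of_le ?_ (openClosureCount_monotone k hn)
  rw [openClosureCount, Set.ncard_pos (LambdaClosure.finite_isMOpen_size_eq k 2)]
  exact ⟨.couple (.lam (.var 0)) .nil, by
    simp [LambdaClosure.IsMOpen, LambdaEnv.IsMOpen, LambdaTerm.IsMOpen, LambdaClosure.size,
      LambdaEnv.size, LambdaTerm.size]⟩

/-! ### Growth rates of supermultiplicative sequences -/

/-- Fekete's lemma for a monotone supermultiplicative sequence of natural numbers with at most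
exponential growth. Monotonicity takes care of zero values, where the logarithm is `0`. -/
lemma exists_tendsto_log_div {a : ℕ → ℕ} (hmul : ∀ m n, a m * a n ≤ a (m + n)) (hmono : Monotone a)
    {r : ℝ} (hr : 0 < r) (hr1 : r ≤ 1) (hbd : ∀ n, (a n : ℝ) * r ^ n ≤ 1) :
    ∃ Λ : ℝ, (∀ n, (a n : ℝ) ≤ Real.exp Λ ^ n) ∧
      Tendsto (fun n : ℕ => Real.log (a n) / n) atTop (𝓝 Λ) := by
  have hlog : ∀ m n, m ≤ n → Real.log (a m) ≤ Real.log (a n) := by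
    intro m n hmn
    rcases Nat.eq_zero_or_pos (a m) with h | h
    · simpa [h] using Real.log_natCast_nonneg (a n)
    · exact Real.log_le_log (by exact_mod_cast h) (by exact_mod_cast hmono hmn)
  have hsub : Subadditive fun n => -Real.log (a n) := by
    intro m n
    rcases Nat.eq_zero_or_pos (a m) with hm | hm
    · simpa [hm] using hlog n (m + n) (by omega)
    rcases Nat.eq_zero_or_pos (a n) with hn | hn
    · simpa [hn] using hlog m (m + n) (by omega)
    have hm' : (0 : ℝ) < a m := by exact_mod_cast hm
    have hn' : (0 : ℝ) < a n := by exact_mod_cast hn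
    have := Real.log_le_log (mul_pos hm' hn')
      (show (a m * a n : ℝ) ≤ a (m + n) by exact_mod_cast hmul m n)
    rw [Real.log_mul hm'.ne' hn'.ne'] at this
    linarith
  have hbelow : BddBelow (Set.range fun n : ℕ => -Real.log (a n) / n) := by
    have hr' : Real.log r ≤ 0 := Real.log_nonpos hr.le hr1
    refine ⟨Real.log r, ?_⟩
    rintro _ ⟨n, rfl⟩
    rcases Nat.eq_zero_or_pos n with rfl | hn
    · simpa using hr'
    dsimp only
    rw [le_div_iff₀ (by exact_mod_cast hn)]
    rcases Nat.eq_zero_or_pos (a n) with h | h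
    · simpa [h] using mul_nonpos_of_nonpos_of_nonneg hr' n.cast_nonneg
    · have h' : (0 : ℝ) < a n := by exact_mod_cast h
      have := Real.log_nonpos (by positivity) (hbd n)
      rw [Real.log_mul h'.ne' (by positivity), Real.log_pow] at this
      linarith
  refine ⟨-hsub.lim, fun n => ?_, ?_⟩
  · rcases Nat.eq_zero_or_pos n with rfl | hn
    · simpa using hbd 0
    rcases Nat.eq_zero_or_pos (a n) with h | h
    · simp only [h, Nat.cast_zero]; positivity
    have h' : (0 : ℝ) < a n := by exact_mod_cast h
    have hle := hsub.lim_le_div hbelow hn.ne'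
    rw [le_div_iff₀ (by exact_mod_cast hn)] at hle
    rw [← Real.exp_nat_mul, ← Real.log_le_iff_le_exp h']
    linarith
  · have := (hsub.tendsto_lim hbelow).neg
    simpa [neg_div] using this

/-- If `a n ^ (1 / n)` tends to `exp Λ ≥ ρ⁻¹`, then `ρ ^ (-n)` is a lower bound for `a n` up to a
subexponential factor. -/
lemma exists_subexponential_lower_bound {a : ℕ → ℕ} (ha : ∀ᶠ n in atTop, 0 < a n) {Λ ρ : ℝ}
    (hρ : 0 < ρ) (hΛ : Tendsto (fun n : ℕ => Real.log (a n) / n) atTop (𝓝 Λ))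
    (h : 0 ≤ Λ + Real.log ρ) :
    ∃ θ : ℕ → ℝ, (∀ n, 0 < θ n) ∧ Tendsto (fun n : ℕ => θ n ^ ((1 : ℝ) / n)) atTop (𝓝 1) ∧
      ∀ᶠ n : ℕ in atTop, ρ ^ (-(n : ℤ)) * θ n < a n := by
  -- The minimum with `1` keeps `θ` from growing exponentially when `exp Λ > ρ⁻¹`.
  refine ⟨fun n => Real.exp (min 0 (Real.log (a n) + n * Real.log ρ)) / 2,
    fun n => by positivity, ?_, ?_⟩
  · have h1 : Tendsto (fun n : ℕ => min 0 (Real.log (a n) / n + Real.log ρ) -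
        Real.log 2 / n) atTop (𝓝 (min 0 (Λ + Real.log ρ) - 0)) :=
      (tendsto_const_nhds.min (hΛ.add_const _)).sub
        (tendsto_const_nhds.div_atTop tendsto_natCast_atTop_atTop)
    rw [min_eq_left h, sub_zero] at h1
    have h2 := (Real.continuous_exp.tendsto 0).comp h1
    rw [Real.exp_zero] at h2
    refine h2.congr' ?_
    filter_upwards [eventually_gt_atTop 0] with n hn
    have hn' : (0 : ℝ) < n := by exact_mod_cast hn
    rw [Function.comp_apply, Real.rpow_def_of_pos (by positivity),
      Real.log_div (by positivity) (by norm_num), Real.log_exp]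
    congr 1
    have : min 0 (Real.log (a n) + n * Real.log ρ)
        = n * min 0 (Real.log (a n) / n + Real.log ρ) := by
      rw [mul_min_of_nonneg _ _ hn'.le]
      congr 1
      · simp
      · field_simp
    rw [this]
    field_simp
  · filter_upwards [ha] with n hn
    have hn' : (0 : ℝ) < a n := by exact_mod_cast hn
    have hle : Real.exp (min 0 (Real.log (a n) + n * Real.log ρ)) ≤ a n * ρ ^ n := by
      refine (Real.exp_le_exp.2 (min_le_right _ _)).trans_eq ?_
      rw [Real.exp_add, Real.exp_log hn', Real.exp_nat_mul, Real.exp_log hρ]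
    rw [zpow_neg, zpow_natCast, inv_mul_lt_iff₀ (by positivity)]
    have : 0 < (a n : ℝ) * ρ ^ n := by positivity
    linarith

/-! ### The bounds on the number of closed closures -/

/-- The upper bound: the generating function of all closures converges at any `x` with
`L_∞(x) ≤ 1 / 4`. -/
lemma openClosureCount_mul_pow_le {x : ℝ} (h0 : 0 ≤ x) (h1 : x < 1)
    (hx : x / (1 - x) + (x * (1 / 4) + x * (1 / 4) * (1 / 4)) ≤ 1 / 4) (k n : ℕ) :
    (openClosureCount k n : ℝ) * x ^ n ≤ 1 / 2 := by
  have h : (openClosureCount k n : ℝ≥0∞) * ENNReal.ofReal x ^ n ≤ 1 / 2 := by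
    refine (ENNReal.le_tsum (f := fun n => (openClosureCount k n : ℝ≥0∞) * ENNReal.ofReal x ^ n)
      n).trans ?_
    rw [← LambdaClosure.genFun_isMOpen_eq_tsum]
    exact (genFun.mono (Set.subset_univ _)).trans (LambdaClosure.genFun_univ_ofReal_le h0 h1 hx)
  have := ENNReal.toReal_mono (by finiteness) h
  simpa [ENNReal.toReal_ofReal h0] using this

lemma ENNReal.le_quarter_of_add_sq_le {a c : ℝ≥0∞} (hc : c ≠ ∞) (h : a + c * c ≤ c) :
    a ≤ ENNReal.ofReal (1 / 4) := by
  have ha : a ≠ ∞ := ne_top_of_le_ne_top hc (le_self_add.trans h)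
  have h' := ENNReal.toReal_mono hc h
  rw [ENNReal.toReal_add ha (ENNReal.mul_ne_top hc hc), ENNReal.toReal_mul] at h'
  rw [ENNReal.le_ofReal_iff_toReal_le ha (by norm_num)]
  nlinarith [sq_nonneg (c.toReal - 1 / 2)]

/-- The lower bound: the generating function `C` of closed closures diverges beyond the solution of
`L_0 = 1 / 4`, because `L_0 ≤ C - C ^ 2 ≤ 1 / 4` wherever `C` converges. -/
lemma growth_add_log_nonneg {ρ Λ : ℝ} (hρ : 0 < ρ)
    (hL : HasSum (fun n : ℕ => (openTermCount 0 n : ℝ) * ρ ^ n) (1 / 4))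
    (hΛ : ∀ n, (openClosureCount 0 n : ℝ) ≤ Real.exp Λ ^ n) : 0 ≤ Λ + Real.log ρ := by
  by_contra! hneg
  -- `ρ * exp δ` lies strictly between `ρ` and `exp (-Λ)`.
  set δ := -(Λ + Real.log ρ) / 2 with hδ
  have hδ0 : 0 < δ := by linarith
  have hz0 : 0 ≤ Real.exp δ * ρ := by positivity
  have hq : Real.exp Λ * (Real.exp δ * ρ) < 1 := by
    rw [← Real.exp_log hρ, ← Real.exp_add, ← Real.exp_add, Real.exp_lt_one_iff]
    linarith
  have hC : genFun LambdaClosure.size {c | c.IsMOpen 0} (ENNReal.ofReal (Real.exp δ * ρ)) ≠ ∞ := by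
    rw [LambdaClosure.genFun_isMOpen_eq_tsum, ← summable_iff_tsum_natCast_ne_top _ hz0]
    refine Summable.of_nonneg_of_le (fun n => by positivity) (fun n => ?_)
      (summable_geometric_of_lt_one (by positivity) hq)
    rw [mul_pow (Real.exp Λ)]
    exact mul_le_mul_of_nonneg_right (hΛ n) (by positivity)
  have h1 := ENNReal.le_quarter_of_add_sq_le hC (LambdaClosure.genFun_closed_add_sq_le _)
  have h2 : genFun LambdaTerm.size {M | M.IsMOpen 0} (ENNReal.ofReal ρ)
      = ENNReal.ofReal (1 / 4) := by
    rw [LambdaTerm.genFun_isMOpen_eq_tsum, ← hL.tsum_eq,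
      ENNReal.ofReal_tsum_of_nonneg (fun n => by positivity) hL.summable]
    refine tsum_congr fun n => ?_
    rw [ENNReal.ofReal_mul (by positivity), ENNReal.ofReal_pow hρ.le, ENNReal.ofReal_natCast]
  have h3 : 1 < Real.exp δ := Real.one_lt_exp_iff.2 hδ0
  have h4 := genFun.mul_le_of_pos (s := {M : LambdaTerm | M.IsMOpen 0}) (z := ENNReal.ofReal ρ)
    LambdaTerm.size_pos (ENNReal.one_le_ofReal.2 h3.le)
  rw [h2, ← ENNReal.ofReal_mul (by positivity), ← ENNReal.ofReal_mul (by positivity)] at h4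
  have h5 := (ENNReal.ofReal_le_ofReal_iff (by norm_num)).1 (h4.trans h1)
  linarith

theorem mainTheorem2 :
    plainTermRadius = ENNReal.ofReal
      ((1 / 3) * ((26 + 6 * √33) ^ ((1 : ℝ) / 3)
        - 4 * (2 : ℝ) ^ ((2 : ℝ) / 3) / (13 + 3 * √33) ^ ((1 : ℝ) / 3) - 1)) ∧
    ∃ ρup ρlow : ℝ,
      ρup = (25 - √545) / 10 ∧
      0 < ρup ∧ ρup < ρlow ∧ ENNReal.ofReal ρlow < plainTermRadius ∧
      HasSum (fun n : ℕ => (openTermCount 0 n : ℝ) * ρlow ^ n) (1 / 4) ∧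
      ∃ θ κ : ℕ → ℝ,
        (∀ n, 0 < θ n) ∧ (∀ n, 0 < κ n) ∧
        Tendsto (fun n : ℕ => θ n ^ ((1 : ℝ) / n)) atTop (𝓝 1) ∧
        Tendsto (fun n : ℕ => κ n ^ ((1 : ℝ) / n)) atTop (𝓝 1) ∧
        ∀ᶠ n : ℕ in atTop,
          ρlow ^ (-(n : ℤ)) * θ n < (openClosureCount 0 n : ℝ) ∧
            (openClosureCount 0 n : ℝ) < ρup ^ (-(n : ℤ)) * κ n := by
  obtain ⟨ρ, hρ⟩ : ∃ ρ : ℝ, ρ = (1 / 3) * ((26 + 6 * √33) ^ ((1 : ℝ) / 3)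
    - 4 * (2 : ℝ) ^ ((2 : ℝ) / 3) / (13 + 3 * √33) ^ ((1 : ℝ) / 3) - 1) := ⟨_, rfl⟩
  have hcub := cardano_root hρ
  rw [← hρ]
  have hρ0 : 295597 / 10 ^ 6 < ρ := cubic_strictMono.lt_iff_lt.1 (by norm_num; linarith)
  have hρ1 : ρ < 1 := cubic_strictMono.lt_iff_lt.1 (by norm_num; linarith)
  have hrad := plainTermRadius_eq (by linarith) hρ1 (by linear_combination -hcub)
  refine ⟨hrad, ?_⟩
  obtain ⟨u, hu⟩ : ∃ u : ℝ, u = (25 - √545) / 10 := ⟨_, rfl⟩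
  have hs : √545 ^ 2 = 545 := Real.sq_sqrt (by norm_num)
  have hs1 : (23 : ℝ) < √545 := Real.lt_sqrt_of_sq_lt (by norm_num)
  have hs2 : √545 < 24 := by rw [Real.sqrt_lt' (by norm_num)]; norm_num
  have hu0 : 0 < u := by rw [hu]; linarith
  have hu1 : u < 1 / 5 := by rw [hu]; linarith
  have hu2 : 5 * u ^ 2 - 25 * u + 4 = 0 := by rw [hu]; linear_combination hs / 20
  -- At `u` the equation for `L_∞` has the root `1 / 4`.
  have hux : u / (1 - u) + (u * (1 / 4) + u * (1 / 4) * (1 / 4)) ≤ 1 / 4 := by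
    have : 1 - u ≠ 0 := by linarith
    refine le_of_eq ?_
    field_simp
    linear_combination -hu2
  have hlt : genFun LambdaTerm.size {M | M.IsMOpen 0} (ENNReal.ofReal u)
      < ENNReal.ofReal (1 / 4) := by
    refine (LambdaTerm.genFun_closed_le hu0.le (by norm_num)
      (LambdaTerm.genFun_univ_le_ofReal hu0.le (by linarith) (by norm_num) hux)).trans_lt ?_
    rw [ENNReal.ofReal_lt_ofReal_iff (by norm_num)]
    linarith
  obtain ⟨l, hul, hlb, hsum⟩ :=
    LambdaTerm.exists_hasSum_quarter hu0.le (by norm_num; linarith) hlt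
  have hl0 : 0 < l := hu0.trans hul
  have hbd := openClosureCount_mul_pow_le hu0.le (by linarith) hux 0
  obtain ⟨Λ, hΛ, hlim⟩ := exists_tendsto_log_div (openClosureCount_mul_le 0)
    (openClosureCount_monotone 0) hu0 (by linarith) fun n => (hbd n).trans (by norm_num)
  obtain ⟨θ, hθ0, hθ, hlow⟩ := exists_subexponential_lower_bound
    ((eventually_ge_atTop 2).mono fun n hn => openClosureCount_pos 0 hn) hl0 hlim
    (growth_add_log_nonneg hl0 hsum hΛ)
  refine ⟨u, l, hu, hu0, hul, ?_, hsum, θ, fun _ => 1, hθ0, fun _ => one_pos, hθ, by simp, ?_⟩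
  · rw [hrad, ENNReal.ofReal_lt_ofReal_iff (by linarith)]
    linarith
  · filter_upwards [hlow] with n hn
    refine ⟨hn, ?_⟩
    rw [mul_one, zpow_neg, zpow_natCast, ← one_div, lt_div_iff₀ (by positivity)]
    exact (hbd n).trans_lt (by norm_num)
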